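/- **Conventions.** Let $\Omega=\mathbb R$, let $\mathcal B_\Omega$ be the $\sigma$-algebra of all universally measurable subsets of $\mathbb R$, and let $\Omega^\Omega$ be the set of all $\mathcal B_\Omega$-$\mathcal B_\Omega$-measurable maps $\Omega\to\Omega$. A *quasi-universal space* is a set $X$ with a set $X^\Omega$ of maps $\Omega\to X$ that contains all constant maps and satisfies $X^\Omega\circ\Omega^\Omega\subseteq X^\Omega$. A map $f:X\to Y$ is *quasi-measurable* if $f\circ X^\Omega\subseteq Y^\Omega$. The set $X$ carries the $\sigma$-algebra $\mathcal B_X=\{A\subseteq X : \alpha^{-1}(A)\in\mathcal B_\Omega \text{ for all } \alpha\in X^\Omega\}$. Put $(X\times Y)^\Omega=X^\Omega\times Y^\Omega$. The set $Y^X$ of all quasi-measurable maps $X\to Y$ is a quasi-universal space, where $\beta:\Omega\to Y^X$ belongs to $(Y^X)^\Omega$ iff $\omega\mapsto\beta(\varphi(\omega))(\alpha(\omega))$ is in $Y^\Omega$ for all $\varphi\in\Omega^\Omega$, $\alpha\in X^\Omega$. Let $Q(\Omega)$ be the set of probability measures $\nu$ on $(\Omega,\mathcal B_\Omega)$ such that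 $\omega\mapsto\nu(D_\omega)$ is measurable for all $D\in\mathcal B_{\Omega\times\Omega}$, where $D_\omega=\{\omega' : (\omega,\omega')\in D\}$; let $Q(\Omega)^\Omega$ be the set of maps $\kappa:\Omega\to Q(\Omega)$ such that $\omega\mapsto\kappa(\varphi(\omega))(D_\omega)$ is measurable for all such $D$ and all $\varphi\in\Omega^\Omega$. Let $P(X)$ be the set of all probability measures on $\mathcal B_X$ of the form $\alpha_*\nu$ with $\alpha\in X^\Omega$, $\nu\in Q(\Omega)$, with $P(X)^\Omega=\{\omega\mapsto\alpha_*(\kappa(\omega)) : \alpha\in X^\Omega,\ \kappa\in Q(\Omega)^\Omega\}$. A quasi-universal space $X$ is *countably separated* if some countable subset of $\mathcal B_X$ separates the points of $X$. It is *universal* if the universal completion of $(X,\mathcal B_X)$ is isomorphic, as a measurable space, to a set $A\in\mathcal B_\Omega$ with the trace $\sigma$-algebra, and $X^\Omega$ is the set of all $\mathcal B_\Omega$-$\mathcal B_X$-measurable maps $\Omega\to X$. A *quotient map* $t:X\to Y$ is a surjective quasi-measurable map with $t\circ X^\Omega=Y^\Omega$. **Theorem.** Let $X,Y,Z$ be quasi-universal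 spaces with $Y$ countably separated, and suppose that $X$ or $Z$ is universal. Then the product of Markov kernels $$\otimes:\ P(X)^{Y\times Z}\times P(Y)^Z\to P(X\times Y)^Z,\qquad (\mu\otimes\nu)(z)(D)=\int \mu(y,z)(\{x : (x,y)\in D\})\,\nu(z)(dy)\quad (D\in\mathcal B_{X\times Y}),$$ is a well-defined (surjective) quotient map. In particular, every $K\in P(X\times Y)^Z$ can be written as $K=\mu\otimes\nu$ with $\mu\in P(X)^{Y\times Z}$ and $\nu\in P(Y)^Z$, where $\nu(z)$ is the $Y$-marginal of $K(z)$ for every $z\in Z$. -/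

import Mathlib

open Set MeasureTheory MeasurableSpace
open scoped ENNReal

noncomputable section

namespace QuasiUniversal

universe u v w

/-- The universal completion of a `σ`-algebra: the intersection of its Lebesgue completions with
respect to all probability measures. -/
@[reducible] def universalCompletion {X : Type u} (m : MeasurableSpace X) : MeasurableSpace X where
  MeasurableSet' A := ∀ μ : Measure[m] X, IsProbabilityMeasure μ → NullMeasurableSet A μ
  measurableSet_empty _ _ := nullMeasurableSet_empty
  measurableSet_compl _ hA μ hμ := (hA μ hμ).compl
  measurableSet_iUnion _ hf μ hμ := NullMeasurableSet.iUnion fun i => hf i μ hμ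

/-- The sample space: the real line with the `σ`-algebra of all universally measurable subsets. -/
def Sample : Type := ℝ

instance : MeasurableSpace Sample := universalCompletion (borel ℝ)

/-- A quasi-universal space: a type `X` with a set `X^Ω` of maps `Ω → X` (its random elements) that
contains the constant maps and is closed under precomposition with all measurable maps `Ω → Ω`. -/
class QUSpace (X : Type u) where
  rand : Set (Sample → X)
  comp_mem : ∀ α ∈ rand, ∀ φ : Sample → Sample, Measurable φ → α ∘ φ ∈ rand
  const_mem : ∀ x : X, (fun _ => x) ∈ rand

/-- `X^Ω`. -/
def rand (X : Type u) [QUSpace X] : Set (Sample → X) := QUSpace.rand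

/-- A map is quasi-measurable if `f ∘ X^Ω ⊆ Y^Ω`. -/
def QuasiMeasurable {X : Type u} {Y : Type v} [QUSpace X] [QUSpace Y] (f : X → Y) : Prop :=
  ∀ α ∈ rand X, f ∘ α ∈ rand Y

/-- The induced `σ`-algebra `B(X^Ω) = {A | ∀ α ∈ X^Ω, α⁻¹(A) ∈ B_Ω}`. -/
@[reducible] def inducedSigma (X : Type u) [QUSpace X] : MeasurableSpace X where
  MeasurableSet' A := ∀ α ∈ rand X, MeasurableSet (α ⁻¹' A)
  measurableSet_empty _ _ := MeasurableSet.empty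
  measurableSet_compl _ hA α hα := (hA α hα).compl
  measurableSet_iUnion f hf α hα := by
    rw [preimage_iUnion]
    exact MeasurableSet.iUnion fun i => hf i α hα

/-- The sample space as a quasi-universal space: `Ω^Ω` is the set of all measurable maps. -/
instance : QUSpace Sample where
  rand := {φ | Measurable φ}
  comp_mem _ hα _ hφ := hα.comp hφ
  const_mem _ := measurable_const

/-- Binary products. -/
instance instProd {X : Type u} {Y : Type v} [QUSpace X] [QUSpace Y] : QUSpace (X × Y) where
  rand := {α | (fun ω => (α ω).1) ∈ rand X ∧ (fun ω => (α ω).2) ∈ rand Y}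
  comp_mem _ hα φ hφ := ⟨QUSpace.comp_mem _ hα.1 φ hφ, QUSpace.comp_mem _ hα.2 φ hφ⟩
  const_mem x := ⟨QUSpace.const_mem x.1, QUSpace.const_mem x.2⟩

/-- The set `Y^X` of quasi-measurable maps `X → Y`. -/
structure QMap (X : Type u) (Y : Type v) [QUSpace X] [QUSpace Y] where
  toFun : X → Y
  quasiMeasurable : QuasiMeasurable toFun

instance {X : Type u} {Y : Type v} [QUSpace X] [QUSpace Y] :
    CoeFun (QMap X Y) (fun _ => X → Y) := ⟨QMap.toFun⟩

/-- The function space: `β ∈ (Y^X)^Ω` iff `ω ↦ β(φ(ω))(α(ω))` is in `Y^Ω` for all `φ ∈ Ω^Ω` and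
all `α ∈ X^Ω`. -/
instance instQMap {X : Type u} {Y : Type v} [QUSpace X] [QUSpace Y] : QUSpace (QMap X Y) where
  rand := {β | ∀ φ ∈ rand Sample, ∀ α ∈ rand X, (fun ω => β (φ ω) (α ω)) ∈ rand Y}
  comp_mem _ hβ ψ hψ φ hφ α hα := hβ (ψ ∘ φ) (hψ.comp hφ) α hα
  const_mem f _ _ α hα := f.quasiMeasurable α hα

/-- The set `Q(Ω)` of probability measures `ν` on `Ω` such that `ω ↦ ν(D_ω)` is measurable for
every `D ∈ B_{Ω × Ω}`. -/
structure SampleProb where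
  measure : Measure Sample
  isProbabilityMeasure : IsProbabilityMeasure measure
  measurable_section : ∀ D : Set (Sample × Sample),
    MeasurableSet[inducedSigma (Sample × Sample)] D →
      Measurable fun ω => measure {ω' | (ω, ω') ∈ D}

/-- `Q(Ω)` as a quasi-universal space: `κ ∈ Q(Ω)^Ω` iff `ω ↦ κ(φ(ω))(D_ω)` is measurable for all
`φ ∈ Ω^Ω` and all `D ∈ B_{Ω × Ω}`. -/
instance instSampleProb : QUSpace SampleProb where
  rand := {κ | ∀ φ ∈ rand Sample, ∀ D : Set (Sample × Sample),
    MeasurableSet[inducedSigma (Sample × Sample)] D →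
      Measurable fun ω => (κ (φ ω)).measure {ω' | (ω, ω') ∈ D}}
  comp_mem _ hκ ψ hψ φ hφ D hD := hκ (ψ ∘ φ) (hψ.comp hφ) D hD
  const_mem ν _ _ D hD := ν.measurable_section D hD

/-- The push-forward `α_* ν`, a measure on the induced `σ`-algebra of `X`. -/
def pushforward {X : Type u} [QUSpace X] (α : Sample → X) (ν : SampleProb) :
    Measure[inducedSigma X] X :=
  @Measure.map Sample X _ (inducedSigma X) α ν.measure

/-- The set `P(X)` of push-forward probability measures `α_* ν` with `α ∈ X^Ω`, `ν ∈ Q(Ω)`. -/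
structure Prob (X : Type u) [QUSpace X] where
  measure : Measure[inducedSigma X] X
  exists_eq : ∃ α ∈ rand X, ∃ ν : SampleProb, measure = pushforward α ν

/-- `P(X)` as a quasi-universal space: `P(X)^Ω` consists of the maps `ω ↦ α_* (κ(ω))` with
`α ∈ X^Ω` and `κ ∈ Q(Ω)^Ω`. -/
instance instProb {X : Type u} [QUSpace X] : QUSpace (Prob X) where
  rand := {p | ∃ α ∈ rand X, ∃ κ ∈ rand SampleProb, ∀ ω, (p ω).measure = pushforward α (κ ω)}
  comp_mem := by
    rintro p ⟨α, hα, κ, hκ, h⟩ φ hφ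
    exact ⟨α, hα, κ ∘ φ, QUSpace.comp_mem κ hκ φ hφ, fun ω => h (φ ω)⟩
  const_mem := by
    rintro ⟨μ, α, hα, ν, h⟩
    exact ⟨α, hα, fun _ => ν, QUSpace.const_mem ν, fun _ => h⟩

/-- A (surjective) quotient map `t : X → Y`: a surjective quasi-measurable map with
`t ∘ X^Ω = Y^Ω`. -/
def IsQuotientMap {X : Type u} {Y : Type v} [QUSpace X] [QUSpace Y] (t : X → Y) : Prop :=
  QuasiMeasurable t ∧ Function.Surjective t ∧ (fun α : Sample → X => t ∘ α) '' rand X = rand Y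

/-- `X` is countably separated if countably many sets of its induced `σ`-algebra separate its
points. -/
def IsCountablySeparated (X : Type u) [QUSpace X] : Prop :=
  @CountablySeparated X (inducedSigma X)

/-- A universal measurable space: its universal completion is isomorphic to a universally
measurable subset of the real line. -/
def IsUniversalMeasurableSpace {X : Type u} (m : MeasurableSpace X) : Prop :=
  ∃ A : Set Sample, MeasurableSet A ∧
    Nonempty (@MeasurableEquiv X A (universalCompletion m) Subtype.instMeasurableSpace)

/-- A universal quasi-universal space: `(X, B(X^Ω))` is a universal measurable space and
`X^Ω` is the set of all measurable maps `Ω → (X, B(X^Ω))`. -/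
def IsUniversal (X : Type u) [QUSpace X] : Prop :=
  IsUniversalMeasurableSpace (inducedSigma X) ∧
    rand X = {α : Sample → X | Measurable[_, inducedSigma X] α}

/-! ### The product of Markov kernels -/

section KernelProduct

variable {X : Type u} {Y : Type v} {Z : Type w} [QUSpace X] [QUSpace Y] [QUSpace Z]

theorem measurable_of_mem_rand {α : Sample → X} (hα : α ∈ rand X) :
    Measurable[_, inducedSigma X] α :=
  fun _ hA => hA α hα

theorem measurableSet_section {D : Set (X × Y)} (hD : MeasurableSet[inducedSigma (X × Y)] D)
    (y : Y) : MeasurableSet[inducedSigma X] {x | (x, y) ∈ D} :=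
  fun α hα => hD (fun ω => (α ω, y)) ⟨hα, QUSpace.const_mem y⟩

theorem measurable_kernel_section (μ : QMap (Y × Z) (Prob X)) (z : Z) {D : Set (X × Y)}
    (hD : MeasurableSet[inducedSigma (X × Y)] D) :
    Measurable[inducedSigma Y] fun y => (μ (y, z)).measure {x | (x, y) ∈ D} := by
  intro S hS β hβ
  obtain ⟨α, hα, κ, hκ, h⟩ :=
    μ.quasiMeasurable (fun ω => (β ω, z)) ⟨hβ, QUSpace.const_mem z⟩
  have hD' : MeasurableSet[inducedSigma (Sample × Sample)]
      {p : Sample × Sample | (α p.2, β p.1) ∈ D} := fun γ hγ =>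
    hD (fun ω => (α (γ ω).2, β (γ ω).1))
      ⟨QUSpace.comp_mem α hα _ hγ.2, QUSpace.comp_mem β hβ _ hγ.1⟩
  have key : Measurable fun ω => (μ (β ω, z)).measure {x | (x, β ω) ∈ D} := by
    have := hκ id measurable_id _ hD'
    convert this using 2 with ω
    have e := h ω
    simp only [Function.comp_apply] at e
    rw [e, pushforward, Measure.map_apply (measurable_of_mem_rand hα)
      (measurableSet_section hD (β ω))]
    rfl
  exact key hS

/-- The measure `(μ ⊗ ν)(z)`, given by `D ↦ ∫ μ(y, z)(D_y) ν(z)(dy)` for `D ∈ B_{X × Y}`. -/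
def kernelProd (μ : QMap (Y × Z) (Prob X)) (ν : QMap Z (Prob Y)) (z : Z) :
    Measure[inducedSigma (X × Y)] (X × Y) :=
  @Measure.ofMeasurable (X × Y) (inducedSigma (X × Y))
    (fun D _ => ∫⁻ y, (μ (y, z)).measure {x | (x, y) ∈ D} ∂(ν z).measure)
    (by simp)
    (by
      intro f hf hd
      rw [← lintegral_tsum fun i => (measurable_kernel_section μ z (hf i)).aemeasurable]
      refine lintegral_congr fun y => ?_
      rw [← measure_iUnion (fun i j hij => ?_) fun i => measurableSet_section (hf i) y]
      · congr 1
        ext x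
        simp
      · exact (hd hij).preimage fun x => (x, y))

theorem kernelProd_apply (μ : QMap (Y × Z) (Prob X)) (ν : QMap Z (Prob Y)) (z : Z)
    {D : Set (X × Y)} (hD : MeasurableSet[inducedSigma (X × Y)] D) :
    kernelProd μ ν z D = ∫⁻ y, (μ (y, z)).measure {x | (x, y) ∈ D} ∂(ν z).measure :=
  @Measure.ofMeasurable_apply _ (inducedSigma (X × Y)) _ _ _ D hD

/-- The `Y`-marginal of a measure on `X × Y`. -/
def marginal (π : Measure[inducedSigma (X × Y)] (X × Y)) : Measure[inducedSigma Y] Y :=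
  @Measure.map (X × Y) Y (inducedSigma (X × Y)) (inducedSigma Y) Prod.snd π

end KernelProduct

end QuasiUniversal

end

open QuasiUniversal

/-!
The product of kernels is quasi-measurable because a pair of samples can be coded by one sample: if
`ν(ζ(ω)) = β_* κ₁(ω)` and `μ(β(ω'), ζ(ω)) = α_* κ₂(ω', ω)`, then `(μ ⊗ ν)(ζ(ω))` is the
push-forward of the law of the coded pair under a Markov kernel on `Ω`
(`exists_pushforward_eq_lintegral`). Everything about `Q(Ω)` reduces to ordinary kernels, as `Q(Ω)`
consists of all probability measures on `Ω` and `Q(Ω)^Ω` of all Markov kernels on `Ω`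
(`mem_rand_sampleProb`). This rests on two facts: `B_Ω` is complete with respect to all probability
measures on it, and sets of `B_{Ω × Ω}` are null measurable for all probability measures.

For the converse, let `K` be in `P(X × Y)^Z` and let `i : Y → ℝ` be a measurable injection, which
exists as `Y` is countably separated. If `X` or `Z` is universal, then it is a retract of `Ω`, and
one can find a single random element `α` of `X` and a kernel `L` from `Z` to `ℝ × ℝ` such that
`L z` is the joint law of `i(y)` and of a sample `ω` with `x = α(ω)`, where `(x, y)` has law `K z`.
If `X` is a retract, then `α` is the retraction; if `Z` is, then the restriction of `K` to `Ω` is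
`(α, β)_* κ(ω)` for one pair `(α, β)`. The regular conditional distributions of `L z` given its
first coordinate are jointly measurable in that coordinate and in `z`. Their push-forwards under `α`
form `μ`, and the `Y`-marginals form `ν` (`exists_disintegration_of_kernel`).

It remains to see that `K z = μ ⊗ ν` on all of `B_{X × Y}`, which is in general much larger than the
`σ`-algebra generated by `α` and `i`. For fixed `z`, the `Y`-component is `b(ω)` for a random
element `b`. A selection `s`, Borel measurable and defined up to null sets, satisfies
`i(b(s(i(b(ω))))) = i(b(ω))` almost surely, hence `b(s(i(b(ω)))) = b(ω)` by injectivity, so sets of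
`B_{X × Y}` may be replaced by universally measurable subsets of `ℝ × ℝ`
(`lintegral_extend_section`).

Applied with the parameter space `Ω × Z` in place of `Z`, the same result lifts random elements of
`P(X × Y)^Z`, so that the product is a quotient map (`exists_rand_kernelProdMap_eq`).
-/

namespace QuasiUniversal

open ProbabilityTheory

universe u v w

/-! ### The sample space -/

/-- The identity `Ω → ℝ`, which forgets the universally measurable sets. -/
def Sample.toReal (ω : Sample) : ℝ := ω

/-- The identity `ℝ → Ω`. -/
def Sample.ofReal (t : ℝ) : Sample := t

theorem measurable_toReal : Measurable Sample.toReal :=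
  fun _ hA _ _ => (MeasurableSet.nullMeasurableSet hA)

theorem nullMeasurableSet_real {A : Set Sample} (hA : MeasurableSet A) (μ : Measure ℝ)
    [h : IsProbabilityMeasure μ] : NullMeasurableSet (Sample.ofReal ⁻¹' A) μ :=
  hA μ h

/-- The extension of a Borel probability measure to the universally measurable sets, as the
restriction of its completion. (It is `0` if `μ` is such that `ofReal` is not measurable for the
completion, which does not happen for probability measures.) -/
noncomputable def extend (μ : Measure ℝ) : Measure Sample :=
  @Measure.map (NullMeasurableSpace ℝ μ) Sample _ _ Sample.ofReal μ.completion

theorem extend_apply (μ : Measure ℝ) [IsProbabilityMeasure μ] {A : Set Sample}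
    (hA : MeasurableSet A) : extend μ A = μ (Sample.ofReal ⁻¹' A) := by
  have hm : @Measurable (NullMeasurableSpace ℝ μ) Sample _ _ Sample.ofReal :=
    fun B hB => nullMeasurableSet_real hB μ
  rw [extend, Measure.map_apply hm hA]
  rfl

instance (μ : Measure ℝ) [IsProbabilityMeasure μ] : IsProbabilityMeasure (extend μ) :=
  ⟨by rw [extend_apply μ .univ, preimage_univ, measure_univ]⟩

/-- Universal completion is idempotent, here for the sample space. Hence measurability on `Ω` can be
checked up to null sets, one probability measure at a time. -/
theorem measurableSet_of_forall_nullMeasurableSet {A : Set Sample}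
    (h : ∀ P : Measure Sample, IsProbabilityMeasure P → NullMeasurableSet A P) :
    MeasurableSet A := by
  change ∀ μ : Measure ℝ, IsProbabilityMeasure μ → NullMeasurableSet (Sample.ofReal ⁻¹' A) μ
  intro μ hμ
  obtain ⟨B, hB, hAB⟩ := h (extend μ) inferInstance
  have h0 := (ae_eq_set.1 hAB)
  have key : ∀ C : Set Sample, extend μ C = 0 → μ (Sample.ofReal ⁻¹' C) = 0 := fun C hC => by
    obtain ⟨C', hCC', hC', h0'⟩ := exists_measurable_superset_of_null hC
    rw [extend_apply μ hC'] at h0'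
    exact measure_mono_null (preimage_mono hCC') h0'
  have hAB' : Sample.ofReal ⁻¹' A =ᵐ[μ] Sample.ofReal ⁻¹' B :=
    ae_eq_set.2 ⟨key _ h0.1, key _ h0.2⟩
  exact (nullMeasurableSet_real hB μ).congr hAB'.symm

theorem measurable_of_forall_aemeasurable {M : Type*} [MeasurableSpace M] {f : Sample → M}
    (h : ∀ P : Measure Sample, IsProbabilityMeasure P → AEMeasurable f P) : Measurable f :=
  fun _ hA => measurableSet_of_forall_nullMeasurableSet fun P hP => (h P hP).nullMeasurable hA

/-- The preimage of a universally measurable set under a Borel measurable map is null measurable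
for every probability measure. -/
theorem nullMeasurableSet_preimage {T : Type*} [MeasurableSpace T] (P : Measure T)
    [IsProbabilityMeasure P] {f : T → Sample} (hf : Measurable fun t => (f t).toReal)
    {A : Set Sample} (hA : MeasurableSet A) : NullMeasurableSet (f ⁻¹' A) P := by
  have : IsProbabilityMeasure (P.map fun t => (f t).toReal) :=
    Measure.isProbabilityMeasure_map hf.aemeasurable
  change NullMeasurableSet ((fun t => (f t).toReal) ⁻¹' (Sample.ofReal ⁻¹' A)) P
  exact (nullMeasurableSet_real hA (P.map fun t => (f t).toReal)).preimage
    (hf.quasiMeasurePreserving P)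

/-- Universally measurable maps into `ℝ` are also measurable for the universally measurable sets of
the codomain. -/
theorem measurable_of_measurable_toReal {f : Sample → Sample}
    (hf : Measurable fun ω => (f ω).toReal) : Measurable f :=
  fun _ hA => measurableSet_of_forall_nullMeasurableSet fun P _ => nullMeasurableSet_preimage P hf hA

theorem measurable_ofReal_comp {f : Sample → ℝ} (hf : Measurable f) :
    Measurable fun ω => Sample.ofReal (f ω) :=
  measurable_of_measurable_toReal hf

/-- A Borel isomorphism `ℝ × ℝ ≃ ℝ`. -/
noncomputable def realProdEquiv : ℝ × ℝ ≃ᵐ ℝ :=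
  PolishSpace.measurableEquivOfNotCountable
    (fun h => by
      have : Countable ℝ := (Prod.mk_left_injective (0 : ℝ)).countable
      exact Cardinal.not_countable_real (Set.countable_univ (α := ℝ)))
    (fun h => Cardinal.not_countable_real (Set.countable_univ (α := ℝ)))

/-- The coding of pairs of samples by samples. -/
noncomputable def pair (ω ω' : Sample) : Sample :=
  Sample.ofReal (realProdEquiv (ω.toReal, ω'.toReal))

/-- The first component of the pair coded by a sample. -/
noncomputable def fstOf (ω : Sample) : Sample := Sample.ofReal (realProdEquiv.symm ω.toReal).1

/-- The second component of the pair coded by a sample. -/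
noncomputable def sndOf (ω : Sample) : Sample := Sample.ofReal (realProdEquiv.symm ω.toReal).2

@[simp] theorem fstOf_pair (ω ω' : Sample) : fstOf (pair ω ω') = ω := by
  simp [fstOf, pair, Sample.ofReal, Sample.toReal]

@[simp] theorem sndOf_pair (ω ω' : Sample) : sndOf (pair ω ω') = ω' := by
  simp [sndOf, pair, Sample.ofReal, Sample.toReal]

theorem measurable_pair {φ ψ : Sample → Sample} (hφ : Measurable φ) (hψ : Measurable ψ) :
    Measurable fun ω => pair (φ ω) (ψ ω) :=
  measurable_ofReal_comp <| realProdEquiv.measurable.comp <|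
    (measurable_toReal.comp hφ).prodMk (measurable_toReal.comp hψ)

theorem measurable_fstOf : Measurable fstOf :=
  measurable_ofReal_comp (realProdEquiv.symm.measurable.comp measurable_toReal).fst

theorem measurable_sndOf : Measurable sndOf :=
  measurable_ofReal_comp (realProdEquiv.symm.measurable.comp measurable_toReal).snd

/-- Preimages of sets in `B_{Ω × Ω}` under pairs of Borel measurable maps are null measurable for
every probability measure, since the coding of pairs is a Borel isomorphism. -/
theorem nullMeasurableSet_pair {T : Type*} [MeasurableSpace T] (P : Measure T)
    [IsProbabilityMeasure P] {a b : T → Sample} (ha : Measurable fun t => (a t).toReal)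
    (hb : Measurable fun t => (b t).toReal) {D : Set (Sample × Sample)}
    (hD : MeasurableSet[inducedSigma (Sample × Sample)] D) :
    NullMeasurableSet {t | (a t, b t) ∈ D} P := by
  have hA : MeasurableSet {ω | (fstOf ω, sndOf ω) ∈ D} :=
    hD (fun ω => (fstOf ω, sndOf ω)) ⟨measurable_fstOf, measurable_sndOf⟩
  have := nullMeasurableSet_preimage P (f := fun t => pair (a t) (b t))
    (realProdEquiv.measurable.comp (ha.prodMk hb)) hA
  simpa [preimage] using this

/-! ### Probability measures and Markov kernels on the sample space -/

/-- Sections of sets in `B_{Ω × Ω}` are measured measurably by every Markov kernel. -/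
theorem measurable_kernel_section_sample (κ : Kernel Sample Sample) [IsMarkovKernel κ]
    {D : Set (Sample × Sample)} (hD : MeasurableSet[inducedSigma (Sample × Sample)] D) :
    Measurable fun ω => κ ω {ω' | (ω, ω') ∈ D} := by
  refine measurable_of_forall_aemeasurable fun P hP => ?_
  have hN : NullMeasurableSet D (P ⊗ₘ κ) :=
    nullMeasurableSet_pair (P ⊗ₘ κ) (measurable_toReal.comp measurable_fst)
      (measurable_toReal.comp measurable_snd) hD
  obtain ⟨E, hE, hDE⟩ := hN
  refine ⟨fun ω => κ ω {ω' | (ω, ω') ∈ E}, Kernel.measurable_kernel_prodMk_left hE, ?_⟩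
  filter_upwards [Measure.ae_ae_of_ae_compProd hDE] with ω hω
  exact measure_congr hω

/-- A kernel into the Borel sets stays a kernel after extension to all universally measurable
sets. -/
theorem measurable_extend (m : Kernel Sample ℝ) [IsMarkovKernel m] :
    Measurable fun ω => extend (m ω) := by
  refine Measure.measurable_of_measurable_coe _ fun A hA => ?_
  refine measurable_of_forall_aemeasurable fun P hP => ?_
  obtain ⟨E, hE, hAE⟩ := nullMeasurableSet_real hA (m ∘ₘ P)
  refine ⟨fun ω => m ω E, Kernel.measurable_coe m hE, ?_⟩
  filter_upwards [Measure.ae_ae_of_ae_comp hAE] with ω hω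
  rw [extend_apply _ hA]
  exact measure_congr hω

/-- Every probability measure on `Ω` belongs to `Q(Ω)`. -/
def SampleProb.ofMeasure (ν : Measure Sample) [h : IsProbabilityMeasure ν] : SampleProb where
  measure := ν
  isProbabilityMeasure := h
  measurable_section _ hD := measurable_kernel_section_sample (Kernel.const Sample ν) hD

instance (ν : SampleProb) : IsProbabilityMeasure ν.measure := ν.isProbabilityMeasure

/-- `Q(Ω)^Ω` consists of all Markov kernels on `Ω`. -/
theorem mem_rand_sampleProb {κ : Sample → SampleProb} :
    κ ∈ rand SampleProb ↔ Measurable fun ω => (κ ω).measure := by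
  constructor
  · intro h
    refine Measure.measurable_of_measurable_coe _ fun A hA => ?_
    exact h id measurable_id {p | p.2 ∈ A} fun γ hγ => hγ.2 hA
  · intro h φ hφ D hD
    let k : Kernel Sample Sample := ⟨fun ω => (κ (φ ω)).measure, h.comp hφ⟩
    have : IsMarkovKernel k := ⟨fun ω => (κ (φ ω)).isProbabilityMeasure⟩
    exact measurable_kernel_section_sample k hD

/-! ### Sections of Borel maps up to null sets -/

open Classical in
/-- On countably many compact sets which together have full measure, the least value of `ι` on the
fibres of `f` is a Borel function of the value of `f`. -/
theorem exists_measurable_ae_section_of_continuous {γ : Type*} [TopologicalSpace γ] [PolishSpace γ]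
    [MeasurableSpace γ] [BorelSpace γ] (P : Measure γ) [IsFiniteMeasure P] {f ι : γ → ℝ}
    (hf : Continuous f) (hι : Continuous ι) {N : Set γ} (hN : MeasurableSet N)
    (hPN : ∀ᵐ x ∂P, x ∈ N) :
    ∃ s : ℝ → ℝ, Measurable s ∧ ∀ᵐ x ∂P, ∃ y ∈ N, ι y = s (f x) ∧ f y = f x := by
  have hK : ∀ n : ℕ, ∃ K ⊆ N, IsCompact K ∧ P (N \ K) < ((n : ℝ≥0∞) + 1)⁻¹ := fun n =>
    hN.exists_isCompact_sdiff_lt (measure_ne_top P N) (by simp)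
  choose K hKN hKc hKP using hK
  -- Sublevel sets of the least value are images of compact sets.
  have himage : ∀ n c, IsCompact (f '' (K n ∩ ι ⁻¹' Iic c)) := fun n c =>
    ((hKc n).inter_right (isClosed_Iic.preimage hι)).image hf
  have himageK : ∀ n, IsCompact (f '' K n) := fun n => (hKc n).image hf
  have hfiber : ∀ n t, IsCompact (ι '' (K n ∩ f ⁻¹' {t})) := fun n t =>
    ((hKc n).inter_right (isClosed_singleton.preimage hf)).image hι
  have hmem : ∀ n t, t ∈ f '' K n → sInf (ι '' (K n ∩ f ⁻¹' {t})) ∈ ι '' (K n ∩ f ⁻¹' {t}) := by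
    rintro n t ⟨x, hx, rfl⟩
    exact (hfiber n (f x)).sInf_mem ⟨ι x, x, ⟨hx, rfl⟩, rfl⟩
  have hmeas : ∀ n, Measurable fun t => sInf (ι '' (K n ∩ f ⁻¹' {t})) := by
    refine fun n => measurable_of_Iic fun c => ?_
    have : (fun t => sInf (ι '' (K n ∩ f ⁻¹' {t}))) ⁻¹' Iic c
        = f '' (K n ∩ ι ⁻¹' Iic c) ∪ ((f '' K n)ᶜ ∩ {_t | 0 ≤ c}) := by
      ext t
      by_cases ht : t ∈ f '' K n
      · simp only [mem_preimage, mem_Iic, mem_union, mem_inter_iff, mem_compl_iff, ht,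
          not_true_eq_false, false_and, or_false]
        constructor
        · intro h
          obtain ⟨y, hy, hyt⟩ := hmem n t ht
          exact ⟨y, ⟨hy.1, by rw [← hyt] at h; exact h⟩, hy.2⟩
        · rintro ⟨x, ⟨hx, hxc⟩, hxt⟩
          exact (csInf_le (hfiber n t).bddBelow ⟨x, ⟨hx, hxt⟩, rfl⟩).trans hxc
      · have h1 : K n ∩ f ⁻¹' {t} = ∅ :=
          eq_empty_of_forall_notMem fun x hx => ht ⟨x, hx.1, hx.2⟩
        have h2 : t ∉ f '' (K n ∩ ι ⁻¹' Iic c) := fun h => ht (image_mono inter_subset_left h)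
        -- Off `f '' K n`, the infimum is that of the empty set, which is `0`.
        rw [mem_preimage, h1, image_empty, Real.sInf_empty, mem_Iic]
        exact ⟨fun h => Or.inr ⟨ht, h⟩, fun h => (h.resolve_left h2).2⟩
    rw [this]
    exact (himage n c).measurableSet.union ((himageK n).measurableSet.compl.inter (.const _))
  let p : ℕ → ℝ → Prop := fun n t => t ∈ f '' K n ∨ t ∉ ⋃ m, f '' K m
  have hp : ∀ t, ∃ n, p n t := fun t => by
    by_cases h : t ∈ ⋃ m, f '' K m
    · exact (mem_iUnion.1 h).imp fun n hn => Or.inl hn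
    · exact ⟨0, Or.inr h⟩
  have hpm : ∀ n, MeasurableSet {t | p n t} := fun n => (himageK n).measurableSet.union
    (MeasurableSet.iUnion fun m => (himageK m).measurableSet).compl
  refine ⟨fun t => sInf (ι '' (K (Nat.find (hp t)) ∩ f ⁻¹' {t})), Measurable.find hmeas hpm hp, ?_⟩
  have hcover : ∀ᵐ x ∂P, x ∈ ⋃ n, K n := by
    have h0 : P (N \ ⋃ n, K n) = 0 := by
      refine le_antisymm (ENNReal.le_of_forall_pos_le_add ?_) bot_le
      intro ε hε _
      obtain ⟨n, hn⟩ := ENNReal.exists_inv_nat_lt (ENNReal.coe_ne_zero.2 hε.ne')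
      calc P (N \ ⋃ n, K n) ≤ P (N \ K n) :=
            measure_mono (sdiff_subset_sdiff_right (subset_iUnion K n))
        _ ≤ ((n : ℝ≥0∞) + 1)⁻¹ := (hKP n).le
        _ ≤ (n : ℝ≥0∞)⁻¹ := ENNReal.inv_le_inv.2 le_self_add
        _ ≤ 0 + ε := by rw [zero_add]; exact hn.le
    filter_upwards [hPN, measure_eq_zero_iff_ae_notMem.1 h0] with x hxN hx
    by_contra h
    exact hx ⟨hxN, h⟩
  filter_upwards [hcover] with x hx
  obtain ⟨m, hm⟩ := mem_iUnion.1 hx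
  have h1 : f x ∈ f '' K (Nat.find (hp (f x))) :=
    (Nat.find_spec (hp (f x))).resolve_right fun h =>
      h (mem_iUnion.2 ⟨m, mem_image_of_mem f hm⟩)
  obtain ⟨y, hy, hys⟩ := hmem _ _ h1
  exact ⟨y, hKN _ hy.1, hys, hy.2⟩

/-- A form of measurable selection, obtained from the continuous case by passing to a finer Polish
topology with the same Borel sets that makes `f` continuous. -/
theorem exists_measurable_ae_section (P : Measure ℝ) [IsFiniteMeasure P] {f : ℝ → ℝ}
    (hf : Measurable f) {N : Set ℝ} (hN : MeasurableSet N) (hPN : ∀ᵐ x ∂P, x ∈ N) :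
    ∃ s : ℝ → ℝ, Measurable s ∧ ∀ᵐ x ∂P, s (f x) ∈ N ∧ f (s (f x)) = f x := by
  have hR : PolishSpace ℝ := inferInstance
  have hB : Real.measurableSpace = borel ℝ := BorelSpace.measurable_eq
  obtain ⟨τ, hτ, hfτ, hpol⟩ := hf.exists_continuous
  have hborel : @BorelSpace ℝ τ _ :=
    @BorelSpace.mk ℝ τ _ (hB.trans (borel_eq_borel_of_le hpol hR hτ).symm)
  obtain ⟨s, hs, h⟩ := @exists_measurable_ae_section_of_continuous ℝ τ hpol _ hborel P _ f id hfτ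
    (continuous_id_of_le hτ) N hN hPN
  refine ⟨s, hs, ?_⟩
  filter_upwards [h] with x hx
  obtain ⟨y, hy, hys, hyf⟩ := hx
  rw [← hys]
  exact ⟨hy, hyf⟩

/-- Measurable selection on the sample space. -/
theorem exists_measurable_ae_section_sample (P : Measure Sample) [IsProbabilityMeasure P]
    {f : Sample → ℝ} (hf : Measurable f) :
    ∃ s : ℝ → ℝ, Measurable s ∧ ∀ᵐ ω ∂P, f (Sample.ofReal (s (f ω))) = f ω := by
  have : IsProbabilityMeasure (P.map Sample.toReal) :=
    Measure.isProbabilityMeasure_map measurable_toReal.aemeasurable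
  have hnull : NullMeasurable (fun t => f (Sample.ofReal t)) (P.map Sample.toReal) :=
    fun A hA => nullMeasurableSet_real (hf hA) (P.map Sample.toReal)
  have hae := hnull.aemeasurable
  obtain ⟨N, hNsub, hN, hN0⟩ :=
    exists_measurable_superset_of_null (ae_iff.1 hae.ae_eq_mk)
  obtain ⟨s, hs, hsP⟩ := exists_measurable_ae_section (P.map Sample.toReal) hae.measurable_mk
    hN.compl (measure_eq_zero_iff_ae_notMem.1 hN0)
  have heq : ∀ x, x ∉ N → f (Sample.ofReal x) = hae.mk _ x := fun x hx => by
    by_contra h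
    exact hx (hNsub h)
  refine ⟨s, hs, ?_⟩
  filter_upwards [ae_of_ae_map measurable_toReal.aemeasurable hsP,
    ae_of_ae_map measurable_toReal.aemeasurable (measure_eq_zero_iff_ae_notMem.1 hN0)] with ω h1 h2
  have h3 : f ω = hae.mk _ ω.toReal := heq _ h2
  rw [heq _ (by rw [h3]; exact h1.1), h3]
  exact h1.2

variable {X : Type u} {Y : Type v} {Z : Type w} [QUSpace X] [QUSpace Y] [QUSpace Z]

/-! ### The product of kernels is well defined -/

theorem measure_ext {μ ν : Measure[inducedSigma X] X}
    (h : ∀ A, MeasurableSet[inducedSigma X] A → μ A = ν A) : μ = ν :=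
  @Measure.ext X (inducedSigma X) μ ν h

theorem Prob.ext_measure {p q : Prob X} (h : p.measure = q.measure) : p = q := by
  cases p; cases q; cases h; rfl

theorem QMap.ext_apply {f g : QMap X Y} (h : ∀ x, f x = g x) : f = g := by
  cases f; cases g; congr 1; exact funext h

theorem pushforward_apply {α : Sample → X} (hα : α ∈ rand X) (ν : SampleProb) {A : Set X}
    (hA : MeasurableSet[inducedSigma X] A) : pushforward α ν A = ν.measure (α ⁻¹' A) :=
  @Measure.map_apply Sample X _ (inducedSigma X) _ _ (measurable_of_mem_rand hα) _ hA

theorem marginal_pushforward {γ : Sample → X × Y} (hγ : γ ∈ rand (X × Y)) (ν : SampleProb) :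
    marginal (pushforward γ ν) = pushforward (fun ω => (γ ω).2) ν :=
  @Measure.map_map _ _ _ _ (inducedSigma (X × Y)) (inducedSigma Y) _ _ _
    (fun _ hA _ hγ' => hA _ hγ'.2) (measurable_of_mem_rand hγ)

/-- The Markov kernel on `Ω` given by an element of `Q(Ω)^Ω`. -/
def toKernel (κ : Sample → SampleProb) (hκ : κ ∈ rand SampleProb) : Kernel Sample Sample :=
  ⟨fun ω => (κ ω).measure, mem_rand_sampleProb.1 hκ⟩

instance (κ : Sample → SampleProb) (hκ : κ ∈ rand SampleProb) : IsMarkovKernel (toKernel κ hκ) :=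
  ⟨fun ω => (κ ω).isProbabilityMeasure⟩

theorem exists_rand_sampleProb_eq (κ : Kernel Sample Sample) [IsMarkovKernel κ] :
    ∃ k ∈ rand SampleProb, ∀ ω, (k ω).measure = κ ω :=
  ⟨fun ω => SampleProb.ofMeasure (κ ω), mem_rand_sampleProb.2 κ.measurable, fun _ => rfl⟩

/-- The map `(ω, ω') ↦ pair ω' (f ω)` need not be measurable for the product `σ`-algebra, but it
still pushes Markov kernels forward to Markov kernels. -/
theorem measurable_map_pair (κ : Kernel Sample Sample) [IsMarkovKernel κ] {f : Sample → Sample}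
    (hf : Measurable f) : Measurable fun ω => (κ ω).map fun ω' => pair ω' (f ω) := by
  refine Measure.measurable_of_measurable_coe _ fun A hA => ?_
  have hD : MeasurableSet[inducedSigma (Sample × Sample)] {p | pair p.2 (f p.1) ∈ A} :=
    fun γ hγ => measurable_pair hγ.2 (hf.comp hγ.1) hA
  convert measurable_kernel_section_sample κ hD using 2 with ω
  exact Measure.map_apply (measurable_pair measurable_id measurable_const) hA

/-- The product of Markov kernels, for random elements that are given as push-forwards. -/
theorem exists_pushforward_eq_lintegral {α : Sample → X} (hα : α ∈ rand X) {β : Sample → Y}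
    (hβ : β ∈ rand Y) {κ₁ κ₂ : Sample → SampleProb} (hκ₁ : κ₁ ∈ rand SampleProb)
    (hκ₂ : κ₂ ∈ rand SampleProb) :
    ∃ γ ∈ rand (X × Y), ∃ κ ∈ rand SampleProb, ∀ ω, ∀ D, MeasurableSet[inducedSigma (X × Y)] D →
      pushforward γ (κ ω) D =
        ∫⁻ ω', pushforward α (κ₂ (pair ω' ω)) {x | (x, β ω') ∈ D} ∂(κ₁ ω).measure := by
  have hpair : ∀ ω, Measurable fun ω' => pair ω' ω := fun ω =>
    measurable_pair measurable_id measurable_const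
  -- `θ ω` is the law of `pair ω' ω` for `ω'` with law `κ₁ ω`, and `τ u` is the law of
  -- `pair ω'' (fstOf u)` for `ω''` with law `κ₂ u`.
  let θ : Kernel Sample Sample := ⟨_, measurable_map_pair (toKernel κ₁ hκ₁) measurable_id⟩
  let τ : Kernel Sample Sample := ⟨_, measurable_map_pair (toKernel κ₂ hκ₂) measurable_fstOf⟩
  have : IsMarkovKernel θ := ⟨fun ω => Measure.isProbabilityMeasure_map (hpair _).aemeasurable⟩
  have : IsMarkovKernel τ := ⟨fun ω => Measure.isProbabilityMeasure_map (hpair _).aemeasurable⟩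
  obtain ⟨κ, hκ, hκe⟩ := exists_rand_sampleProb_eq (τ ∘ₖ θ)
  have hγ : (fun ω => (α (fstOf ω), β (sndOf ω))) ∈ rand (X × Y) :=
    ⟨QUSpace.comp_mem α hα _ measurable_fstOf, QUSpace.comp_mem β hβ _ measurable_sndOf⟩
  refine ⟨_, hγ, κ, hκ, fun ω D hD => ?_⟩
  have hA : MeasurableSet ((fun ω => (α (fstOf ω), β (sndOf ω))) ⁻¹' D) := hD _ hγ
  rw [pushforward_apply hγ _ hD, hκe, Kernel.comp_apply' _ _ _ hA]
  have hθ : θ ω = (κ₁ ω).measure.map fun ω' => pair ω' ω := rfl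
  rw [hθ, lintegral_map (Kernel.measurable_coe τ hA) (hpair ω)]
  refine lintegral_congr fun ω' => ?_
  have hτ : τ (pair ω' ω) = (κ₂ (pair ω' ω)).measure.map fun ω'' => pair ω'' (fstOf (pair ω' ω)) :=
    rfl
  rw [hτ, Measure.map_apply (hpair _) hA, pushforward_apply hα _ (measurableSet_section hD _)]
  simp [preimage]

/-- The kernel `m` is represented along the random element `(β(ω'), ζ(ω))` of `Y × Z`, with the pair
`(ω', ω)` coded by a single sample. -/
theorem exists_kernelProd_eq_pushforward {m : Sample → QMap (Y × Z) (Prob X)}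
    (hm : m ∈ rand (QMap (Y × Z) (Prob X))) {n : Sample → QMap Z (Prob Y)}
    (hn : n ∈ rand (QMap Z (Prob Y))) {ζ : Sample → Z} (hζ : ζ ∈ rand Z) :
    ∃ γ ∈ rand (X × Y), ∃ κ ∈ rand SampleProb,
      ∀ ω, kernelProd (m ω) (n ω) (ζ ω) = pushforward γ (κ ω) := by
  obtain ⟨β, hβ, κ₁, hκ₁, h₁⟩ := hn id measurable_id ζ hζ
  obtain ⟨α, hα, κ₂, hκ₂, h₂⟩ := hm sndOf measurable_sndOf (fun ω => (β (fstOf ω), ζ (sndOf ω)))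
    ⟨QUSpace.comp_mem β hβ _ measurable_fstOf, QUSpace.comp_mem ζ hζ _ measurable_sndOf⟩
  obtain ⟨γ, hγ, κ, hκ, h⟩ := exists_pushforward_eq_lintegral hα hβ hκ₁ hκ₂
  refine ⟨γ, hγ, κ, hκ, fun ω => measure_ext fun D hD => ?_⟩
  rw [h ω D hD, kernelProd_apply _ _ _ hD]
  have h₁' : (n ω (ζ ω)).measure = pushforward β (κ₁ ω) := h₁ ω
  rw [h₁', pushforward, @lintegral_map _ _ _ (inducedSigma Y) _ _ _
    (measurable_kernel_section (m ω) (ζ ω) hD) (measurable_of_mem_rand hβ)]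
  refine lintegral_congr fun ω' => ?_
  have h₂' := h₂ (pair ω' ω)
  simp only [fstOf_pair, sndOf_pair] at h₂'
  rw [h₂']

/-- The product of Markov kernels as a map `P(X)^{Y × Z} × P(Y)^Z → P(X × Y)^Z`. -/
noncomputable def kernelProdMap (p : QMap (Y × Z) (Prob X) × QMap Z (Prob Y)) : QMap Z (Prob (X × Y)) where
  toFun z :=
    { measure := kernelProd p.1 p.2 z
      exists_eq := by
        obtain ⟨γ, hγ, κ, -, h⟩ := exists_kernelProd_eq_pushforward (QUSpace.const_mem p.1)
          (QUSpace.const_mem p.2) (QUSpace.const_mem z)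
        exact ⟨γ, hγ, κ (0 : ℝ), h (0 : ℝ)⟩ }
  quasiMeasurable _ hζ :=
    exists_kernelProd_eq_pushforward (QUSpace.const_mem p.1) (QUSpace.const_mem p.2) hζ

theorem quasiMeasurable_kernelProdMap :
    QuasiMeasurable (kernelProdMap (X := X) (Y := Y) (Z := Z)) :=
  fun _ hp φ hφ _ hζ => exists_kernelProd_eq_pushforward
    (QUSpace.comp_mem _ hp.1 φ hφ) (QUSpace.comp_mem _ hp.2 φ hφ) hζ

/-! ### Disintegration -/

/-- Regular conditional distributions on `ℝ × ℝ`, which only control Borel sets, disintegrate every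
set of `B_{X × Y}`: by measurable selection, the `Y`-component `b ω` is almost surely a function
`b (s (i (b ω)))` of its real code, so the set can be replaced by a universally measurable subset of
`ℝ × ℝ`. -/
theorem lintegral_extend_section (P : Measure Sample) [IsProbabilityMeasure P] {α : Sample → X}
    (hα : α ∈ rand X) {b : Sample → Y} (hb : b ∈ rand Y) {g : Sample → Sample} (hg : Measurable g)
    {i : Y → ℝ} (hi : Measurable[inducedSigma Y] i) (hinj : Function.Injective i)
    (ρ : Kernel ℝ ℝ) [IsMarkovKernel ρ]
    (hρ : (P.map fun ω => i (b ω)) ⊗ₘ ρ = P.map fun ω => (i (b ω), (g ω).toReal))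
    {D : Set (X × Y)} (hD : MeasurableSet[inducedSigma (X × Y)] D) :
    ∫⁻ ω, extend (ρ (i (b ω))) {ω' | (α ω', b ω) ∈ D} ∂P = P {ω | (α (g ω), b ω) ∈ D} := by
  have hib : Measurable fun ω => i (b ω) :=
    @Measurable.comp _ _ _ _ (inducedSigma Y) _ _ _ hi (measurable_of_mem_rand hb)
  have hpair : Measurable fun ω => (i (b ω), (g ω).toReal) :=
    hib.prodMk (measurable_toReal.comp hg)
  obtain ⟨s, hs, hsP⟩ := exists_measurable_ae_section_sample P hib
  have hbs : ∀ᵐ ω ∂P, b (Sample.ofReal (s (i (b ω)))) = b ω := hsP.mono fun ω h => hinj h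
  have : IsProbabilityMeasure (P.map fun ω => i (b ω)) :=
    Measure.isProbabilityMeasure_map hib.aemeasurable
  have hsm : Measurable fun ω : Sample => Sample.ofReal (s ω.toReal) :=
    measurable_ofReal_comp (hs.comp measurable_toReal)
  have hD₁ : MeasurableSet[inducedSigma (Sample × Sample)]
      {p : Sample × Sample | (α p.2, b (Sample.ofReal (s p.1.toReal))) ∈ D} := fun γ hγ =>
    hD (fun ω => (α (γ ω).2, b (Sample.ofReal (s (γ ω).1.toReal))))
      ⟨QUSpace.comp_mem α hα _ hγ.2, QUSpace.comp_mem b hb _ (hsm.comp hγ.1)⟩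
  -- The universally measurable substitute for `D` on the real codes.
  let D₂ : Set (ℝ × ℝ) := {p | (α (Sample.ofReal p.2), b (Sample.ofReal (s p.1))) ∈ D}
  have hD₂ : NullMeasurableSet D₂ ((P.map fun ω => i (b ω)) ⊗ₘ ρ) :=
    nullMeasurableSet_pair _ (a := fun p : ℝ × ℝ => Sample.ofReal p.1)
      (b := fun p : ℝ × ℝ => Sample.ofReal p.2) measurable_fst measurable_snd hD₁
  obtain ⟨E, hE, hDE⟩ := id hD₂
  have hsec : ∀ᵐ ω ∂P, ρ (i (b ω)) (Prod.mk (i (b ω)) ⁻¹' E)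
      = extend (ρ (i (b ω))) {ω' | (α ω', b ω) ∈ D} := by
    filter_upwards [hbs, ae_of_ae_map hib.aemeasurable (Measure.ae_ae_of_ae_compProd hDE)]
      with ω h1 h2
    refine Eq.trans ?_ (extend_apply _ (measurableSet_section hD (b ω) α hα)).symm
    refine measure_congr ?_
    filter_upwards [h2] with t ht
    refine ht.symm.trans ?_
    change ((α (Sample.ofReal t), b (Sample.ofReal (s (i (b ω))))) ∈ D) = _
    rw [h1]
    rfl
  have hfinal : {ω | (i (b ω), (g ω).toReal) ∈ D₂} =ᵐ[P] {ω | (α (g ω), b ω) ∈ D} := by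
    filter_upwards [hbs] with ω h1
    change ((α (g ω), b (Sample.ofReal (s (i (b ω))))) ∈ D) = _
    rw [h1]
    rfl
  calc ∫⁻ ω, extend (ρ (i (b ω))) {ω' | (α ω', b ω) ∈ D} ∂P
      = ∫⁻ ω, ρ (i (b ω)) (Prod.mk (i (b ω)) ⁻¹' E) ∂P :=
        lintegral_congr_ae (hsec.mono fun ω h => h.symm)
    _ = ((P.map fun ω => i (b ω)) ⊗ₘ ρ) E := by
        rw [Measure.compProd_apply hE,
          lintegral_map (Kernel.measurable_kernel_prodMk_left hE) hib]
    _ = ((P.map fun ω => i (b ω)) ⊗ₘ ρ) D₂ := (measure_congr hDE).symm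
    _ = P {ω | (i (b ω), (g ω).toReal) ∈ D₂} := by
        rw [hρ] at hD₂ ⊢
        exact Measure.map_apply₀ hpair.aemeasurable hD₂
    _ = P {ω | (α (g ω), b ω) ∈ D} := measure_congr hfinal

/-- `K` disintegrates as soon as its `X`-components factor through one random element `α` and the
joint laws `L z` of the real codes of the `Y`-components and of the `α`-coordinates form a kernel.
The conditional distributions of `L z` are jointly measurable in `z` and the code of `y`. -/
theorem exists_disintegration_of_kernel {K : QMap Z (Prob (X × Y))} {i : Y → ℝ}
    (hi : Measurable[inducedSigma Y] i) (hinj : Function.Injective i) {α : Sample → X}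
    (hα : α ∈ rand X) {L : Z → Measure (ℝ × ℝ)} (hL : Measurable[inducedSigma Z, _] L)
    (hKL : ∀ z, ∃ b ∈ rand Y, ∃ g : Sample → Sample, Measurable g ∧ ∃ ν : SampleProb,
      (K z).measure = pushforward (fun ω => (α (g ω), b ω)) ν ∧
      L z = ν.measure.map fun ω => (i (b ω), (g ω).toReal)) :
    ∃ μ : QMap (Y × Z) (Prob X), ∀ z, ∀ D, MeasurableSet[inducedSigma (X × Y)] D →
      (K z).measure D = ∫⁻ y, (μ (y, z)).measure {x | (x, y) ∈ D} ∂marginal (K z).measure := by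
  let _ : MeasurableSpace Z := inducedSigma Z
  have hib : ∀ {b : Sample → Y}, b ∈ rand Y → Measurable fun ω => i (b ω) := fun hb =>
    @Measurable.comp _ _ _ _ (inducedSigma Y) _ _ _ hi (measurable_of_mem_rand hb)
  let Lk : Kernel Z (ℝ × ℝ) := ⟨L, hL⟩
  have : IsMarkovKernel Lk := ⟨fun z => by
    obtain ⟨b, hb, g, hg, ν, -, h⟩ := hKL z
    change IsProbabilityMeasure (L z)
    rw [h]
    exact Measure.isProbabilityMeasure_map
      ((hib hb).prodMk (measurable_toReal.comp hg)).aemeasurable⟩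
  let ρ : Kernel (Z × ℝ) ℝ := Lk.condKernel
  let μ : QMap (Y × Z) (Prob X) :=
    { toFun := fun p => ⟨pushforward α (SampleProb.ofMeasure (extend (ρ (p.2, i p.1)))),
        α, hα, _, rfl⟩
      quasiMeasurable := by
        intro γ hγ
        have hγm : Measurable fun ω => ((γ ω).2, i (γ ω).1) :=
          Measurable.prodMk (measurable_of_mem_rand hγ.2) (hib hγ.1)
        exact ⟨α, hα, fun ω => SampleProb.ofMeasure (extend (ρ ((γ ω).2, i (γ ω).1))),
          mem_rand_sampleProb.2 (measurable_extend (ρ.comap _ hγm)), fun ω => rfl⟩ }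
  refine ⟨μ, fun z D hD => ?_⟩
  obtain ⟨b, hb, g, hg, ν, hK, hLz⟩ := hKL z
  have hr : (fun ω => (α (g ω), b ω)) ∈ rand (X × Y) := ⟨QUSpace.comp_mem α hα g hg, hb⟩
  have hmarg : marginal (K z).measure = pushforward b ν := by
    rw [hK, marginal_pushforward hr]
  have hdis : (ν.measure.map fun ω => i (b ω)) ⊗ₘ (ρ.comap (Prod.mk z) measurable_prodMk_left)
      = ν.measure.map fun ω => (i (b ω), (g ω).toReal) := by
    have h1 : (Lk.fst ⊗ₖ ρ) z = Lk z := by rw [Kernel.disintegrate]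
    have h2 : Lk z = ν.measure.map fun ω => (i (b ω), (g ω).toReal) := hLz
    have h3 : Lk.fst z = ν.measure.map fun ω => i (b ω) := by
      rw [Kernel.fst_apply, h2]
      exact Measure.map_map measurable_fst ((hib hb).prodMk (measurable_toReal.comp hg))
    rw [← h2, ← h1, ← h3]
    ext E hE
    rw [Measure.compProd_apply hE, Kernel.compProd_apply hE]
    rfl
  rw [hmarg, hK, pushforward_apply hr _ hD, pushforward, @lintegral_map _ _ _ (inducedSigma Y) _ _ _
    (measurable_kernel_section μ z hD) (measurable_of_mem_rand hb)]
  refine (lintegral_extend_section ν.measure hα hb hg hi hinj _ hdis hD).symm.trans ?_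
  refine lintegral_congr fun ω => ?_
  exact (pushforward_apply hα (SampleProb.ofMeasure (extend (ρ (z, i (b ω)))))
    (measurableSet_section hD (b ω))).symm

/-! ### Universal and countably separated spaces -/

theorem exists_measurable_injective_real (hY : IsCountablySeparated Y) :
    ∃ i : Y → ℝ, Measurable[inducedSigma Y] i ∧ Function.Injective i := by
  let _ : MeasurableSpace Y := inducedSigma Y
  have : CountablySeparated Y := hY
  obtain ⟨f, hf, hinj⟩ := measurable_injection_nat_bool_of_countablySeparated Y
  exact ⟨_, (measurable_embeddingReal (ℕ → Bool)).comp hf,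
    (measurableEmbedding_embeddingReal (ℕ → Bool)).injective.comp hinj⟩

/-- `X` is a retract of the sample space: there are `j : X → Ω` and `α ∈ X^Ω` with `α ∘ j = id`. The
retraction `α` is defined on all of `Ω`, so `X` is nonempty. -/
def IsSampleRetract (X : Type u) [QUSpace X] : Prop :=
  ∃ j : X → Sample, QuasiMeasurable j ∧ ∃ α ∈ rand X, ∀ x, α (j x) = x

theorem IsSampleRetract.sample_prod (h : IsSampleRetract Z) : IsSampleRetract (Sample × Z) := by
  obtain ⟨j, hj, α, hα, hαj⟩ := h
  refine ⟨fun p => pair p.1 (j p.2), fun γ hγ => measurable_pair hγ.1 (hj _ hγ.2),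
    fun ω => (fstOf ω, α (sndOf ω)), ⟨measurable_fstOf, QUSpace.comp_mem α hα _ measurable_sndOf⟩,
    fun p => ?_⟩
  simp [hαj]

/-- The induced `σ`-algebra is universally complete. -/
theorem measurableSet_inducedSigma_of_universalCompletion {A : Set X}
    (hA : MeasurableSet[universalCompletion (inducedSigma X)] A) :
    MeasurableSet[inducedSigma X] A := by
  intro α hα
  refine measurableSet_of_forall_nullMeasurableSet fun P hP => ?_
  let _ : MeasurableSpace X := inducedSigma X
  have hαm : Measurable α := measurable_of_mem_rand hα
  exact (hA (P.map α) (Measure.isProbabilityMeasure_map hαm.aemeasurable)).preimage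
    (hαm.quasiMeasurePreserving P)

theorem IsUniversal.isSampleRetract (h : IsUniversal X) [Nonempty X] : IsSampleRetract X := by
  classical
  obtain ⟨⟨A, hA, ⟨⟨e, he, he'⟩⟩⟩, hrand⟩ := h
  let α : Sample → X := fun ω => if hω : ω ∈ A then e.symm ⟨ω, hω⟩ else Classical.arbitrary X
  refine ⟨fun x => e x, fun γ hγ B hB => ?_, α, ?_, fun x => ?_⟩
  · have h1 : MeasurableSet[universalCompletion (inducedSigma X)] {x | (e x : Sample) ∈ B} :=
      he (measurable_subtype_coe hB)
    exact measurableSet_inducedSigma_of_universalCompletion h1 γ hγ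
  · rw [hrand]
    let _ : MeasurableSpace X := inducedSigma X
    have h1 : Measurable fun a : A => e.symm a := fun B hB =>
      he' fun μ _ => hB.nullMeasurableSet
    exact Measurable.dite h1 measurable_const hA
  · simp [α]

/-! ### Existence of disintegrations -/

/-- The disintegration of `K` against its `Y`-marginals. If `X` is universal, the `X`-component is
coded by a sample through the section of its retraction; if `Z` is a retract, one representation of
`K` along the retraction serves all `z`, and the sample that drives it is the code of the
`X`-component. -/
theorem exists_disintegration (hY : IsCountablySeparated Y)
    (h : IsUniversal X ∨ (Nonempty Z → IsSampleRetract Z)) (K : QMap Z (Prob (X × Y))) :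
    ∃ μ : QMap (Y × Z) (Prob X), ∀ z, ∀ D, MeasurableSet[inducedSigma (X × Y)] D →
      (K z).measure D = ∫⁻ y, (μ (y, z)).measure {x | (x, y) ∈ D} ∂marginal (K z).measure := by
  rcases isEmpty_or_nonempty Z with hZ | ⟨⟨z₀⟩⟩
  · exact ⟨⟨fun p => hZ.elim p.2, fun γ _ => hZ.elim (γ (0 : ℝ)).2⟩, fun z => hZ.elim z⟩
  obtain ⟨i, hi, hinj⟩ := exists_measurable_injective_real hY
  have hib : ∀ {b : Sample → Y}, b ∈ rand Y → Measurable fun ω => i (b ω) := fun hb =>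
    @Measurable.comp _ _ _ _ (inducedSigma Y) _ _ _ hi (measurable_of_mem_rand hb)
  rcases h with hX | hZ
  · have : Nonempty X := by
      obtain ⟨γ, -⟩ := (K z₀).exists_eq
      exact ⟨(γ (0 : ℝ)).1⟩
    obtain ⟨j, hj, α, hα, hαj⟩ := hX.isSampleRetract
    let q : X × Y → ℝ × ℝ := fun p => (i p.2, (j p.1).toReal)
    have hqγ : ∀ {γ : Sample → X × Y}, γ ∈ rand (X × Y) → Measurable fun ω => q (γ ω) :=
      fun hγ => (hib hγ.2).prodMk (measurable_toReal.comp (hj _ hγ.1))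
    have hq : Measurable[inducedSigma (X × Y), _] q := fun E hE γ hγ => hqγ hγ hE
    have hmap : ∀ {γ : Sample → X × Y}, γ ∈ rand (X × Y) → ∀ ν : SampleProb,
        @Measure.map _ _ (inducedSigma (X × Y)) _ q (pushforward γ ν)
          = ν.measure.map fun ω => q (γ ω) := fun hγ ν =>
      @Measure.map_map _ _ _ _ (inducedSigma (X × Y)) _ _ _ _ hq (measurable_of_mem_rand hγ)
    refine exists_disintegration_of_kernel hi hinj hα
      (L := fun z => @Measure.map _ _ (inducedSigma (X × Y)) _ q (K z).measure) ?_ fun z => ?_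
    · intro S hS ζ hζ
      obtain ⟨γ, hγ, κ, hκ, hK⟩ := K.quasiMeasurable ζ hζ
      have h1 : Measurable fun ω => (κ ω).measure.map fun ω' => q (γ ω') :=
        (Measure.measurable_map _ (hqγ hγ)).comp (mem_rand_sampleProb.1 hκ)
      convert h1 hS using 1
      ext ω
      have hKω : (K (ζ ω)).measure = pushforward γ (κ ω) := hK ω
      rw [mem_preimage, mem_preimage, mem_preimage, hKω, hmap hγ]
    · obtain ⟨γ, hγ, ν, hK⟩ := (K z).exists_eq
      refine ⟨_, hγ.2, fun ω => j (γ ω).1, hj _ hγ.1, ν, ?_, ?_⟩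
      · simpa only [hαj] using hK
      · rw [hK, hmap hγ]
  · obtain ⟨j, hj, ζ₀, hζ₀, hζj⟩ := hZ ⟨z₀⟩
    obtain ⟨γ, hγ, κ, hκ, hK⟩ := K.quasiMeasurable ζ₀ hζ₀
    have hm : Measurable fun ω => (i (γ ω).2, ω.toReal) := (hib hγ.2).prodMk measurable_toReal
    refine exists_disintegration_of_kernel hi hinj hγ.1
      (L := fun z => (κ (j z)).measure.map fun ω => (i (γ ω).2, ω.toReal)) ?_ fun z => ?_
    · exact fun S hS ζ hζ => ((Measure.measurable_map _ hm).comp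
        ((mem_rand_sampleProb.1 hκ).comp (hj ζ hζ))) hS
    · refine ⟨_, hγ.2, id, measurable_id, κ (j z), ?_, rfl⟩
      have := hK (j z)
      simp only [Function.comp_apply, hζj] at this
      exact this

/-- The `Y`-marginal of a kernel. -/
noncomputable def marginalMap (K : QMap Z (Prob (X × Y))) : QMap Z (Prob Y) where
  toFun z :=
    { measure := marginal (K z).measure
      exists_eq := by
        obtain ⟨γ, hγ, ν, h⟩ := (K z).exists_eq
        exact ⟨_, hγ.2, ν, by rw [h, marginal_pushforward hγ]⟩ }
  quasiMeasurable ζ hζ := by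
    obtain ⟨γ, hγ, κ, hκ, h⟩ := K.quasiMeasurable ζ hζ
    refine ⟨_, hγ.2, κ, hκ, fun ω => ?_⟩
    rw [← marginal_pushforward hγ, ← h ω]
    rfl

/-- Every random element of `P(X × Y)^Z` is the product of random kernels. It is disintegrated over
the parameter space `Ω × Z`, which makes the conditional kernels measurable in the random
parameter. -/
theorem exists_rand_kernelProdMap_eq (hY : IsCountablySeparated Y)
    (h : IsUniversal X ∨ IsUniversal Z) {K : Sample → QMap Z (Prob (X × Y))}
    (hK : K ∈ rand (QMap Z (Prob (X × Y)))) :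
    ∃ p ∈ rand (QMap (Y × Z) (Prob X) × QMap Z (Prob Y)), ∀ ω,
      (p ω).2 = marginalMap (K ω) ∧ kernelProdMap (p ω) = K ω := by
  let K' : QMap (Sample × Z) (Prob (X × Y)) :=
    ⟨fun q => K q.1 q.2, fun γ hγ => hK _ hγ.1 _ hγ.2⟩
  obtain ⟨μ, hμ⟩ := exists_disintegration hY
    (h.imp_right fun hZ (hne : Nonempty (Sample × Z)) =>
      have : Nonempty Z := hne.map Prod.snd
      hZ.isSampleRetract.sample_prod) K'
  let m : Sample → QMap (Y × Z) (Prob X) := fun ω => ⟨fun q => μ (q.1, (ω, q.2)), fun γ hγ =>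
    μ.quasiMeasurable (fun ω' => ((γ ω').1, (ω, (γ ω').2))) ⟨hγ.1, measurable_const, hγ.2⟩⟩
  refine ⟨fun ω => (m ω, marginalMap (K ω)), ⟨?_, ?_⟩, fun ω => ⟨rfl, ?_⟩⟩
  · exact fun φ hφ γ hγ =>
      μ.quasiMeasurable (fun ω => ((γ ω).1, (φ ω, (γ ω).2))) ⟨hγ.1, hφ, hγ.2⟩
  · exact fun φ hφ ζ hζ => (marginalMap K').quasiMeasurable (fun ω => (φ ω, ζ ω)) ⟨hφ, hζ⟩
  · refine QMap.ext_apply fun z => Prob.ext_measure (measure_ext fun D hD => ?_)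
    exact (kernelProd_apply (m ω) (marginalMap (K ω)) z hD).trans (hμ (ω, z) D hD).symm

end QuasiUniversal

theorem mainTheorem8 {X : Type*} {Y : Type*} {Z : Type*} [QUSpace X] [QUSpace Y] [QUSpace Z]
    (hY : IsCountablySeparated Y) (hXZ : IsUniversal X ∨ IsUniversal Z) :
    ∃ T : QMap (Y × Z) (Prob X) × QMap Z (Prob Y) → QMap Z (Prob (X × Y)),
      (∀ μ ν z, (T (μ, ν) z).measure = kernelProd μ ν z) ∧
      IsQuotientMap T ∧
      ∀ K : QMap Z (Prob (X × Y)), ∃ (μ : QMap (Y × Z) (Prob X)) (ν : QMap Z (Prob Y)),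
        (∀ z, (ν z).measure = marginal (K z).measure) ∧ T (μ, ν) = K := by
  have hsurj : ∀ K : QMap Z (Prob (X × Y)), ∃ (μ : QMap (Y × Z) (Prob X)) (ν : QMap Z (Prob Y)),
      (∀ z, (ν z).measure = marginal (K z).measure) ∧ kernelProdMap (μ, ν) = K := fun K => by
    obtain ⟨p, -, hp⟩ := exists_rand_kernelProdMap_eq hY hXZ (QUSpace.const_mem K)
    refine ⟨(p (0 : ℝ)).1, (p (0 : ℝ)).2, fun z => ?_, (hp (0 : ℝ)).2⟩
    rw [(hp (0 : ℝ)).1]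
    rfl
  refine ⟨kernelProdMap, fun _ _ _ => rfl, ⟨quasiMeasurable_kernelProdMap, fun K => ?_, ?_⟩, hsurj⟩
  · obtain ⟨μ, ν, -, h⟩ := hsurj K
    exact ⟨_, h⟩
  · refine Subset.antisymm ?_ fun K hK => ?_
    · rintro _ ⟨p, hp, rfl⟩
      exact quasiMeasurable_kernelProdMap p hp
    · obtain ⟨p, hp, hpK⟩ := exists_rand_kernelProdMap_eq hY hXZ hK
      exact ⟨p, hp, funext fun ω => (hpK ω).2⟩
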